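/- Theorem (Lower bound on the spatial outage capacity, random link distances). Fix a path loss exponent $\alpha>2$ and put $\delta = 2/\alpha\in(0,1)$; let $\theta>0$ and $\epsilon\in(0,1)$. For $\lambda>0$ and $p\in(0,1]$ consider the Poisson bipolar network with ALOHA and Rayleigh fading whose link distances are Rayleigh distributed with $\mu=1$, seen from its typical link. That is: the typical receiver is at the origin and its always active transmitter is at $(R,0)$, where $R$ has density $2\pi a e^{-\pi a^2}$, $a>0$ (so $\mathbb{E}R=1/2$); the other potential transmitters form a homogeneous Poisson point process $\Phi=\{z_n\}\subset\mathbb{R}^2$ of density $\lambda$; the activity indicators $B_n$ are i.i.d. Bernoulli$(p)$; the channel power gains $h, h_n$ are i.i.d. exponential with mean $1$; and $\Phi$, $R$, $(B_n)$ and the gains $(h,h_n)$ are independent. Let $$\mathsf{SIR}=\frac{hR^{-\alpha}}{\sum_n B_n h_n\|z_n\|^{-\alpha}},\qquad P_{\rm s}(\theta)=\mathbb{P}(\mathsf{SIR}>\theta\mid\Phi,R),\qquad \eta(\theta,\epsilon)=\mathbb{P}\bigl(P_{\rm s}(\theta)>1-\epsilon\bigr),$$ where $\eta(\theta,\epsilon)$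 depends on $(\lambda,p)$, and let the spatial outage capacity be $$S(\theta,\epsilon)=\sup_{\lambda>0,\;p\in(0,1]}\lambda p\,\eta(\theta,\epsilon).$$ Then $$S(\theta,\epsilon) > \frac{(1-\sqrt{1-\epsilon})^{2}}{\epsilon\,\theta^{\delta}\,\Gamma(1+\delta)\,\Gamma(1-\delta)}.$$ -/

import Mathlib

open MeasureTheory ProbabilityTheory

universe u

/-- `Φ` is a Poisson point process with intensity measure `Λ` on the probability space `(Ω, P)`:
the counts of sets of finite `Λ`-measure are Poisson distributed with mean `Λ A`, and the counts of
pairwise disjoint sets are independent. (Below, `Φ` is a sum of Dirac masses.) -/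
structure IsPoissonPointProcess {Ω E : Type*} [MeasurableSpace Ω] [MeasurableSpace E]
    (Φ : Ω → Measure E) (Λ : Measure E) (P : Measure Ω) : Prop where
  measurable : Measurable Φ
  law_count : ∀ A : Set E, MeasurableSet A → Λ A ≠ ⊤ →
    P.map (fun ω ↦ Φ ω A) = (poissonMeasure (Λ A).toNNReal).map (fun n : ℕ ↦ (n : ENNReal))
  indep_count : ∀ (k : ℕ) (A : Fin k → Set E), (∀ i, MeasurableSet (A i)) →
    Pairwise (fun i j ↦ Disjoint (A i) (A j)) → iIndepFun (fun i ω ↦ Φ ω (A i)) P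

/-- The Rayleigh distribution with density `2πμ a exp (-πμ a²)`, `a > 0`,
whose mean is `1 / (2 √μ)`. -/
noncomputable def rayleighMeasure (mu : ℝ) : Measure ℝ :=
  volume.withDensity fun a ↦
    ENNReal.ofReal (if 0 < a then 2 * Real.pi * mu * a * Real.exp (-(Real.pi * mu * a ^ 2)) else 0)

/-- The configuration of point masses at the locations `x 0, x 1, …`. -/
noncomputable def pointConfiguration (x : ℕ → EuclideanSpace ℝ (Fin 2)) :
    Measure (EuclideanSpace ℝ (Fin 2)) :=
  Measure.sum fun n ↦ Measure.dirac (x n)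

/-- The Poisson bipolar network with ALOHA and Rayleigh fading, with Rayleigh distributed link
distances, seen from its typical link: the typical receiver is at the origin, its always active
transmitter is at `(R, 0)`, and the other potential transmitters form a homogeneous
Poisson point process of density `lam` on the plane, independent of the typical link. -/
structure RayleighBipolarNetwork (lam mu p : ℝ) where
  /-- The sample space. -/
  Ω : Type u
  [mΩ : MeasurableSpace Ω]
  /-- The probability measure. -/
  P : Measure Ω
  [isProb : IsProbabilityMeasure P]
  /-- `X n` is the location of the `n`-th interfering potential transmitter. -/
  X : ℕ → Ω → EuclideanSpace ℝ (Fin 2)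
  /-- The distance of the typical link. -/
  R : Ω → ℝ
  /-- `B n` tells whether the `n`-th interferer transmits in the time slot. -/
  B : ℕ → Ω → Bool
  /-- Channel power gains to the typical receiver: `h none` from its own transmitter, and
  `h (some n)` from the `n`-th interferer. -/
  h : Option ℕ → Ω → ℝ
  measurable_X : ∀ n, Measurable (X n)
  measurable_R : Measurable R
  measurable_B : ∀ n, Measurable (B n)
  measurable_h : ∀ i, Measurable (h i)
  poisson : IsPoissonPointProcess (fun ω ↦ pointConfiguration fun n ↦ X n ω)
    (ENNReal.ofReal lam • (volume : Measure (EuclideanSpace ℝ (Fin 2)))) P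
  law_R : P.map R = rayleighMeasure mu
  law_B : ∀ n, P.real {ω | B n ω = true} = p
  law_h : ∀ i, P.map (h i) = expMeasure 1
  indep_B : iIndepFun B P
  indep_h : iIndepFun h P
  indep_X_rest : IndepFun (fun ω n ↦ X n ω) (fun ω ↦ (R ω, (fun n ↦ B n ω), fun i ↦ h i ω)) P
  indep_R_marks : IndepFun R (fun ω ↦ ((fun n ↦ B n ω), fun i ↦ h i ω)) P
  indep_B_h : IndepFun (fun ω n ↦ B n ω) (fun ω i ↦ h i ω) P

attribute [instance] RayleighBipolarNetwork.mΩ RayleighBipolarNetwork.isProb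

namespace RayleighBipolarNetwork

/-- The point process of the interfering potential transmitters. -/
noncomputable def Phi {lam mu p : ℝ} (N : RayleighBipolarNetwork lam mu p) (ω : N.Ω) :
    Measure (EuclideanSpace ℝ (Fin 2)) :=
  pointConfiguration fun n ↦ N.X n ω

/-- The interference at the typical receiver, with path loss exponent `α` and unit power. -/
noncomputable def interference {lam mu p : ℝ} (N : RayleighBipolarNetwork lam mu p) (α : ℝ)
    (ω : N.Ω) : ENNReal :=
  ∑' n : ℕ, if N.B n ω = true then ENNReal.ofReal (N.h (some n) ω) * ‖N.X n ω‖ₑ ^ (-α) else 0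

/-- The signal-to-interference ratio at the typical receiver. -/
noncomputable def SIR {lam mu p : ℝ} (N : RayleighBipolarNetwork lam mu p) (α : ℝ)
    (ω : N.Ω) : ENNReal :=
  ENNReal.ofReal (N.h none ω) * ENNReal.ofReal (N.R ω) ^ (-α) / N.interference α ω

/-- The information in the network geometry: the point process of transmitters and the
link distance (both are constant over time). -/
noncomputable abbrev geometry {lam mu p : ℝ} (N : RayleighBipolarNetwork lam mu p) : MeasurableSpace N.Ω :=
  MeasurableSpace.comap (fun ω ↦ (N.Phi ω, N.R ω)) inferInstance

/-- The conditional link success probability `P_s(θ)`: the conditional probability of `SIR > θ`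
given the network geometry. -/
noncomputable def successProb {lam mu p : ℝ} (N : RayleighBipolarNetwork lam mu p) (α θ : ℝ) :
    N.Ω → ℝ :=
  N.P[Set.indicator {ω | ENNReal.ofReal θ < N.SIR α ω} (fun _ ↦ (1 : ℝ)) | N.geometry]

/-- The fraction `η(θ, ε) = P(P_s(θ) > 1 - ε)` of reliable links. -/
noncomputable def eta {lam mu p : ℝ} (N : RayleighBipolarNetwork lam mu p) (α θ ε : ℝ) : ℝ :=
  N.P.real {ω | 1 - ε < N.successProb α θ ω}

end RayleighBipolarNetwork

/-- The spatial outage capacity `S(θ, ε)`: the supremum (in `[0, ∞]`) of `λ p η(θ, ε)` over all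
densities `λ > 0` of potential transmitters and all transmit probabilities `p ∈ (0, 1]`, where
`N` provides the network for each pair `(λ, p)`. -/
noncomputable def spatialOutageCapacity {mu : ℝ}
    (N : ∀ lam p : ℝ, 0 < lam → 0 < p → p ≤ 1 → RayleighBipolarNetwork.{u} lam mu p)
    (α θ ε : ℝ) : ENNReal :=
  ⨆ (lam : ℝ) (p : ℝ) (hlam : 0 < lam) (hp : 0 < p) (hp1 : p ≤ 1),
    ENNReal.ofReal (lam * p * (N lam p hlam hp hp1).eta α θ ε)

/-!
Write `K = θ ^ δ Γ(1 + δ) Γ(1 - δ)` and `L = -log (1 - ε)`. Given the locations `zₙ` and the link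
distance `R`, averaging over the fading and the ALOHA indicators gives the success probability
`∏ₙ (1 - p fₙ)` with the loss factors `fₙ = θ R ^ α / (‖zₙ‖ ^ α + θ R ^ α)`. Since
`1 - p f ≥ exp (-(p / (1 - p)) f)` for `0 ≤ f ≤ 1`, it is at least
`exp (-(p / (1 - p)) ∑ₙ fₙ)` (`expNeg_le_prod_measure_tsum_ite_lt`), so the link is reliable as
soon as `(p / (1 - p)) ∑ₙ fₙ < L` (`RayleighBipolarNetwork.ae_lt_successProb`).

Only the mean of the loss sum is needed beyond this. The intensity measure of the interferers is
`lam` times the Lebesgue measure, the loss factor integrates to `π R² K` over the plane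
(`lintegral_inv_one_add_inv_pathloss`), and `E[R²] = 1 / π`, so the mean is `lam K`
(`RayleighBipolarNetwork.lintegral_lossSum`). Markov's inequality then yields
`η ≥ 1 - lam p K / ((1 - p) L)` (`RayleighBipolarNetwork.one_sub_le_eta`).

At `lam p K = (1 - p) L / 2` this makes `lam p η` at least `(1 - p) L / (4 K)`. With
`s = √(1 - ε)`, the elementary inequality `log (1 / s) > 2 (1 - s) / (1 + s)` says that
`L / 4 > (1 - s) / (1 + s) = (1 - s)² / ε`, and the inequality being strict, it survives the factor
`1 - p` for all sufficiently small `p`.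
-/

open scoped ENNReal

/-! ### The decreasing exponential on `[0, ∞]` -/

/-- The function `t ↦ exp (-t)` on `[0, ∞]`, with `exp (-∞) = 0`. -/
noncomputable def expNeg (t : ℝ≥0∞) : ℝ≥0∞ := EReal.exp (-(t : EReal))

@[simp] lemma expNeg_zero : expNeg 0 = 1 := by simp [expNeg]

@[simp] lemma expNeg_top : expNeg ⊤ = 0 := by simp [expNeg]

lemma expNeg_ofReal {x : ℝ} (hx : 0 ≤ x) :
    expNeg (ENNReal.ofReal x) = ENNReal.ofReal (Real.exp (-x)) := by
  rw [expNeg, EReal.coe_ennreal_ofReal, max_eq_left hx, ← EReal.coe_neg, EReal.exp_coe]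

lemma continuous_expNeg : Continuous expNeg :=
  ENNReal.continuous_exp.comp (continuous_neg.comp continuous_coe_ennreal_ereal)

lemma measurable_expNeg : Measurable expNeg := continuous_expNeg.measurable

lemma strictAnti_expNeg : StrictAnti expNeg := fun _ _ hab ↦
  EReal.exp_strictMono (EReal.neg_lt_neg_iff.2 (EReal.coe_ennreal_lt_coe_ennreal_iff.2 hab))

lemma expNeg_add (s t : ℝ≥0∞) : expNeg (s + t) = expNeg s * expNeg t := by
  rw [expNeg, expNeg, expNeg, EReal.coe_ennreal_add, ← EReal.exp_add,
    EReal.neg_add (by simp) (by simp), sub_eq_add_neg]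

lemma expNeg_sum {ι : Type*} (s : Finset ι) (f : ι → ℝ≥0∞) :
    expNeg (∑ i ∈ s, f i) = ∏ i ∈ s, expNeg (f i) := by
  classical
  induction s using Finset.induction_on with
  | empty => simp
  | insert a s ha ih => rw [Finset.sum_insert ha, Finset.prod_insert ha, expNeg_add, ih]

lemma expNeg_le_one (t : ℝ≥0∞) : expNeg t ≤ 1 := by
  simpa using strictAnti_expNeg.antitone (zero_le : 0 ≤ t)

lemma expNeg_tsum (f : ℕ → ℝ≥0∞) :
    expNeg (∑' n, f n) = ⨅ N, ∏ n ∈ Finset.range N, expNeg (f n) := by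
  have hanti : Antitone fun N ↦ expNeg (∑ n ∈ Finset.range N, f n) := fun M N hMN ↦
    strictAnti_expNeg.antitone (Finset.sum_le_sum_of_subset (Finset.range_mono hMN))
  simp_rw [← expNeg_sum]
  exact tendsto_nhds_unique
    ((continuous_expNeg.tendsto _).comp ENNReal.summable.hasSum.tendsto_sum_nat)
    (tendsto_atTop_iInf hanti)

lemma antitone_prod_range {f : ℕ → ℝ≥0∞} (hf : ∀ n, f n ≤ 1) :
    Antitone fun N ↦ ∏ n ∈ Finset.range N, f n :=
  antitone_nat_of_succ_le fun N ↦ by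
    rw [Finset.prod_range_succ]
    exact mul_le_of_le_one_right' (hf N)

/-! ### Exponential variables -/

lemma expMeasure_one_setOf_lt_ofReal (t : ℝ≥0∞) :
    expMeasure 1 {x | t < ENNReal.ofReal x} = expNeg t := by
  have := isProbabilityMeasure_expMeasure (r := 1) one_pos
  induction t with
  | top => simp
  | coe t =>
    have hset : {x : ℝ | (t : ℝ≥0∞) < ENNReal.ofReal x} = (Set.Iic (t : ℝ))ᶜ := by
      ext x
      rw [Set.mem_ofPred_eq, ← ENNReal.ofReal_coe_nnreal, ENNReal.ofReal_lt_ofReal_iff_of_nonneg t.coe_nonneg]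
      simp
    have h1 : expMeasure 1 (Set.Iic (t : ℝ)) = ENNReal.ofReal (1 - Real.exp (-(t : ℝ))) := by
      rw [← ofReal_cdf, cdf_expMeasure_eq one_pos, if_pos t.coe_nonneg, one_mul]
    rw [hset, prob_compl_eq_one_sub measurableSet_Iic, h1, ← ENNReal.ofReal_coe_nnreal,
      expNeg_ofReal t.coe_nonneg, ← ENNReal.ofReal_one, ← ENNReal.ofReal_sub _ (by simp)]
    simp

lemma expMeasure_eq_withDensity (r : ℝ) :
    expMeasure r = volume.withDensity (exponentialPDF r) := rfl

/-- The Laplace transform of the standard exponential distribution. -/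
lemma lintegral_expNeg_expMeasure_one (c : ℝ≥0∞) :
    ∫⁻ x, expNeg (ENNReal.ofReal x * c) ∂(expMeasure 1) = (1 + c)⁻¹ := by
  have hpdf : ∀ r, Measurable (exponentialPDF r) := fun r ↦
    (measurable_exponentialPDFReal r).ennreal_ofReal
  have hE : Measurable fun x : ℝ ↦ expNeg (ENNReal.ofReal x * c) :=
    measurable_expNeg.comp (by fun_prop)
  rw [expMeasure_eq_withDensity, lintegral_withDensity_eq_lintegral_mul _ (hpdf 1) hE]
  induction c with
  | top =>
    rw [add_top, ENNReal.inv_top, lintegral_eq_zero_iff ((hpdf 1).mul hE)]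
    filter_upwards [Measure.ae_ne volume (0 : ℝ)] with x hx
    rcases lt_or_gt_of_ne hx with h | h
    · simp [exponentialPDF_of_neg h]
    · simp [ENNReal.mul_top, h]
  | coe c =>
    have hc : (0 : ℝ) < 1 + c := by positivity
    -- up to the factor `(1 + c)⁻¹` the integrand is the density of the exponential law of rate `1 + c`
    have key : ∀ x, (exponentialPDF 1 * fun x ↦ expNeg (ENNReal.ofReal x * c)) x
        = (1 + (c : ℝ≥0∞))⁻¹ * exponentialPDF (1 + c) x := by
      intro x
      have hinv : (1 + (c : ℝ≥0∞))⁻¹ = ENNReal.ofReal (1 + (c : ℝ))⁻¹ := by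
        rw [ENNReal.ofReal_inv_of_pos hc, ENNReal.ofReal_add zero_le_one c.coe_nonneg]
        simp
      rcases lt_or_ge x 0 with h | h
      · simp [exponentialPDF_of_neg h]
      · rw [Pi.mul_apply, exponentialPDF_of_nonneg h, exponentialPDF_of_nonneg h,
          ← ENNReal.ofReal_coe_nnreal, ← ENNReal.ofReal_mul h, expNeg_ofReal (by positivity),
          ENNReal.ofReal_coe_nnreal, hinv,
          ← ENNReal.ofReal_mul (by positivity), ← ENNReal.ofReal_mul (by positivity)]
        congr 1
        rw [one_mul, ← Real.exp_add, ← mul_assoc, inv_mul_cancel₀ hc.ne', one_mul]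
        ring_nf
    rw [lintegral_congr key, lintegral_const_mul _ (hpdf _), lintegral_exponentialPDF_eq_one hc,
      mul_one]

/-! ### The success probability for a given geometry -/

section Fading

variable {Ω : Type*} [MeasurableSpace Ω] {P : Measure Ω} [IsProbabilityMeasure P]

/-- An exponential gain that is independent of `T` exceeds it with probability `E[exp (-T)]`. -/
lemma measure_lt_ofReal_eq_lintegral_expNeg {T : Ω → ℝ≥0∞} {g : Ω → ℝ} (hT : Measurable T)
    (hg : Measurable g) (hTg : IndepFun T g P) (hlaw : P.map g = expMeasure 1) :
    P {ω | T ω < ENNReal.ofReal (g ω)} = ∫⁻ ω, expNeg (T ω) ∂P := by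
  have hS : MeasurableSet {z : ℝ≥0∞ × ℝ | z.1 < ENNReal.ofReal z.2} :=
    measurableSet_lt measurable_fst (by fun_prop)
  have : IsProbabilityMeasure (expMeasure 1) := isProbabilityMeasure_expMeasure one_pos
  rw [indepFun_iff_map_prod_eq_prod_map_map hT.aemeasurable hg.aemeasurable, hlaw] at hTg
  calc P {ω | T ω < ENNReal.ofReal (g ω)}
      = P.map (fun ω ↦ (T ω, g ω)) {z | z.1 < ENNReal.ofReal z.2} := by
        rw [Measure.map_apply (hT.prodMk hg) hS]; rfl
    _ = ∫⁻ ω, expNeg (T ω) ∂P := by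
        rw [hTg, Measure.prod_apply hS, ← lintegral_map measurable_expNeg hT]
        exact lintegral_congr fun t ↦ expMeasure_one_setOf_lt_ofReal t

/-- Success probability under Rayleigh fading alone, with relative received powers `c n`. -/
lemma measure_tsum_mul_lt_eq_iInf_prod {h : Option ℕ → Ω → ℝ} (hm : ∀ i, Measurable (h i))
    (hind : iIndepFun h P) (hlaw : ∀ i, P.map (h i) = expMeasure 1) (c : ℕ → ℝ≥0∞) :
    P {ω | ∑' n, ENNReal.ofReal (h (some n) ω) * c n < ENNReal.ofReal (h none ω)}
      = ⨅ N, ∏ n ∈ Finset.range N, (1 + c n)⁻¹ := by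
  have hTm : Measurable fun ω ↦ ∑' n, ENNReal.ofReal (h (some n) ω) * c n := by fun_prop
  have hvec : IndepFun (fun ω n ↦ h (some n) ω) (h none) P := by
    refine indep_of_indep_of_le_left (indep_of_indep_of_le_right
      (indep_iSup_of_disjoint (fun i ↦ (hm i).comap_le) hind
        (S := Set.range some) (T := {none}) (by simp)) ?_) ?_
    · exact le_iSup₂_of_le none rfl le_rfl
    · rw [MeasurableSpace.pi, MeasurableSpace.comap_iSup]
      refine iSup_le fun n ↦ ?_
      rw [MeasurableSpace.comap_comp]
      exact le_iSup₂_of_le (f := fun i _ ↦ MeasurableSpace.comap (h i) inferInstance)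
        (some n) ⟨n, rfl⟩ le_rfl
  have hTind : IndepFun (fun ω ↦ ∑' n, ENNReal.ofReal (h (some n) ω) * c n) (h none) P :=
    hvec.comp (φ := fun y : ℕ → ℝ ↦ ∑' n, ENNReal.ofReal (y n) * c n) (by fun_prop) measurable_id
  rw [measure_lt_ofReal_eq_lintegral_expNeg hTm (hm none) hTind (hlaw none)]
  simp_rw [expNeg_tsum]
  have hfm : ∀ n, Measurable fun x : ℝ ↦ expNeg (ENNReal.ofReal x * c n) := fun n ↦
    measurable_expNeg.comp (by fun_prop)
  rw [lintegral_iInf (f := fun N ω ↦ ∏ n ∈ Finset.range N,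
      expNeg (ENNReal.ofReal (h (some n) ω) * c n))
    (fun N ↦ Finset.measurable_prod _ fun n _ ↦ (hfm n).comp (hm _))
    (fun M N hMN ω ↦ antitone_prod_range (fun n ↦ expNeg_le_one _) hMN) (by simp)]
  refine iInf_congr fun N ↦ ?_
  have hind' : iIndepFun (fun n ω ↦ expNeg (ENNReal.ofReal (h (some n) ω) * c n)) P :=
    (hind.precomp (Option.some_injective ℕ)).comp _ hfm
  rw [lintegral_prod_eq_prod_lintegral_of_indepFun _ _ hind' fun n ↦ (hfm n).comp (hm _)]
  refine Finset.prod_congr rfl fun n _ ↦ ?_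
  rw [← lintegral_expNeg_expMeasure_one, ← hlaw (some n), lintegral_map (hfm n) (hm _)]

/-- The elementary inequality `1 - p f ≥ exp (-(p / (1 - p)) f)` for `0 ≤ f = a / (1 + a) ≤ 1`,
in extended nonnegative reals. -/
lemma expNeg_le_thinned_inv {p : ℝ} (hp : 0 < p) (hp1 : p < 1) (a : ℝ≥0∞) :
    expNeg (ENNReal.ofReal (p / (1 - p)) * (1 + a⁻¹)⁻¹)
      ≤ ENNReal.ofReal p * (1 + a)⁻¹ + ENNReal.ofReal (1 - p) := by
  have hq : 0 < 1 - p := by linarith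
  have key : ∀ f : ℝ, 0 ≤ f → f ≤ 1 → Real.exp (-(p / (1 - p) * f)) ≤ 1 - p * f := by
    intro f hf0 hf1
    have h1 : 0 < 1 - p * f := by nlinarith
    rw [Real.exp_neg]
    refine inv_le_of_inv_le₀ h1 ((?_ : _ ≤ p / (1 - p) * f + 1).trans (Real.add_one_le_exp _))
    rw [inv_le_iff_one_le_mul₀ h1, div_mul_eq_mul_div, div_add_one hq.ne', div_mul_eq_mul_div,
      le_div_iff₀ hq]
    nlinarith [mul_nonneg hp.le hf0, mul_nonneg (mul_nonneg hp.le hf0) (sub_nonneg.2 hf1)]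
  induction a with
  | top =>
    rw [ENNReal.inv_top, add_zero, inv_one, mul_one, expNeg_ofReal (by positivity), add_top,
      ENNReal.inv_top, mul_zero, zero_add]
    exact ENNReal.ofReal_le_ofReal (by simpa using key 1 zero_le_one le_rfl)
  | coe a =>
    have ha : (0 : ℝ) < 1 + a := by positivity
    have h1 : (1 + (a : ℝ≥0∞))⁻¹ = ENNReal.ofReal (1 + (a : ℝ))⁻¹ := by
      rw [ENNReal.ofReal_inv_of_pos ha, ENNReal.ofReal_add zero_le_one a.coe_nonneg]
      simp
    have h2 : (1 + (a : ℝ≥0∞)⁻¹)⁻¹ = ENNReal.ofReal (a / (1 + a)) := by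
      rcases eq_or_ne a 0 with rfl | h0
      · simp
      · have h0' : (0 : ℝ) < a := by positivity
        rw [← ENNReal.ofReal_coe_nnreal, ← ENNReal.ofReal_inv_of_pos h0', ← ENNReal.ofReal_one,
          ← ENNReal.ofReal_add (by positivity) (by positivity),
          ← ENNReal.ofReal_inv_of_pos (by positivity)]
        congr 1
        field_simp
        ring
    rw [h1, h2, ← ENNReal.ofReal_mul (by positivity), expNeg_ofReal (by positivity),
      ← ENNReal.ofReal_mul hp.le, ← ENNReal.ofReal_add (by positivity) hq.le]
    refine ENNReal.ofReal_le_ofReal ((key _ (by positivity) ?_).trans_eq ?_)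
    · rw [div_le_one ha]; linarith
    · field_simp
      ring

/-- Given the geometry, the success probability under ALOHA and Rayleigh fading is
`∏ₙ (1 - p aₙ / (1 + aₙ))`, where `aₙ` is the relative received power of the `n`-th interferer;
it is therefore at least `exp (-(p / (1 - p)) ∑ₙ aₙ / (1 + aₙ))`. -/
lemma expNeg_le_prod_measure_tsum_ite_lt {B : ℕ → Ω → Bool} {h : Option ℕ → Ω → ℝ} {p : ℝ}
    (hp : 0 < p) (hp1 : p < 1) (hBm : ∀ n, Measurable (B n)) (hBind : iIndepFun B P)
    (hBlaw : ∀ n, P.real {ω | B n ω = true} = p) (hm : ∀ i, Measurable (h i))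
    (hind : iIndepFun h P) (hlaw : ∀ i, P.map (h i) = expMeasure 1) (a : ℕ → ℝ≥0∞) :
    expNeg (ENNReal.ofReal (p / (1 - p)) * ∑' n, (1 + (a n)⁻¹)⁻¹)
      ≤ ((P.map fun ω n ↦ B n ω).prod (P.map fun ω i ↦ h i ω))
        {v | ∑' n, (if v.1 n = true then ENNReal.ofReal (v.2 (some n)) * a n else 0)
          < ENNReal.ofReal (v.2 none)} := by
  have hBm' : Measurable fun ω n ↦ B n ω := measurable_pi_lambda _ hBm
  have hm' : Measurable fun ω i ↦ h i ω := measurable_pi_lambda _ hm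
  have hS : MeasurableSet {v : (ℕ → Bool) × (Option ℕ → ℝ) |
      ∑' n, (if v.1 n = true then ENNReal.ofReal (v.2 (some n)) * a n else 0)
          < ENNReal.ofReal (v.2 none)} := by
    refine measurableSet_lt (Measurable.tsum fun n ↦ Measurable.ite ?_ (by fun_prop)
      measurable_const) (by fun_prop)
    exact measurableSet_eq_fun (by fun_prop) measurable_const
  have hfm : ∀ n, Measurable fun b : Bool ↦ (1 + (if b = true then a n else 0))⁻¹ := fun n ↦
    measurable_of_finite _
  have hle : ∀ (n : ℕ) (b : Bool), (1 + (if b = true then a n else 0))⁻¹ ≤ 1 := fun n b ↦ by simp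
  have hpm : ∀ N, Measurable fun b : ℕ → Bool ↦
      ∏ n ∈ Finset.range N, (1 + (if b n = true then a n else 0))⁻¹ := fun N ↦
    Finset.measurable_prod _ fun n _ ↦ (hfm n).comp (measurable_pi_apply n)
  have hind' : iIndepFun (fun n ω ↦ (1 + (if B n ω = true then a n else 0))⁻¹) P :=
    hBind.comp _ hfm
  have hone : ∀ n, ∫⁻ ω, (1 + (if B n ω = true then a n else 0))⁻¹ ∂P
      = ENNReal.ofReal p * (1 + a n)⁻¹ + ENNReal.ofReal (1 - p) := by
    intro n
    have hset : MeasurableSet {ω | B n ω = true} :=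
      measurableSet_eq_fun (hBm n) measurable_const
    have hP : P {ω | B n ω = true} = ENNReal.ofReal p := by rw [← hBlaw n, ofReal_measureReal]
    have hPc : P {ω | B n ω = true}ᶜ = ENNReal.ofReal (1 - p) := by
      rw [prob_compl_eq_one_sub hset, hP, ENNReal.ofReal_sub _ hp.le, ENNReal.ofReal_one]
    rw [← lintegral_add_compl _ hset, setLIntegral_congr_fun (g := fun _ ↦ (1 + a n)⁻¹) hset
      fun ω hω ↦ ?_, setLIntegral_congr_fun (g := fun _ ↦ 1) hset.compl fun ω hω ↦ ?_]
    · rw [setLIntegral_const, setLIntegral_const, hP, hPc, one_mul, mul_comm]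
    · have : ¬ B n ω = true := hω
      simp [this]
    · have : B n ω = true := hω
      simp [this]
  have hsec : ∀ b : ℕ → Bool, (P.map fun ω i ↦ h i ω)
      {y | ∑' n, (if b n = true then ENNReal.ofReal (y (some n)) * a n else 0)
          < ENNReal.ofReal (y none)}
      = ⨅ N, ∏ n ∈ Finset.range N, (1 + (if b n = true then a n else 0))⁻¹ := by
    intro b
    have hSb : MeasurableSet {y : Option ℕ → ℝ |
        ∑' n, (if b n = true then ENNReal.ofReal (y (some n)) * a n else 0)
          < ENNReal.ofReal (y none)} := measurable_prodMk_left (x := b) hS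
    rw [Measure.map_apply hm' hSb, ← measure_tsum_mul_lt_eq_iInf_prod hm hind hlaw]
    simp_rw [mul_ite, mul_zero]
    rfl
  rw [Measure.prod_apply hS]
  calc expNeg (ENNReal.ofReal (p / (1 - p)) * ∑' n, (1 + (a n)⁻¹)⁻¹)
      ≤ ⨅ N, ∏ n ∈ Finset.range N, (ENNReal.ofReal p * (1 + a n)⁻¹ + ENNReal.ofReal (1 - p)) := by
        rw [← ENNReal.tsum_mul_left, expNeg_tsum]
        exact iInf_mono fun N ↦ Finset.prod_le_prod' fun n _ ↦ expNeg_le_thinned_inv hp hp1 _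
    _ = ⨅ N, ∫⁻ ω, ∏ n ∈ Finset.range N, (1 + (if B n ω = true then a n else 0))⁻¹ ∂P := by
        refine iInf_congr fun N ↦ ?_
        rw [lintegral_prod_eq_prod_lintegral_of_indepFun _ _ hind' fun n ↦ (hfm n).comp (hBm n)]
        exact Finset.prod_congr rfl fun n _ ↦ (hone n).symm
    _ = ∫⁻ b, ⨅ N, ∏ n ∈ Finset.range N, (1 + (if b n = true then a n else 0))⁻¹
          ∂(P.map fun ω n ↦ B n ω) := by
        rw [lintegral_map (Measurable.iInf hpm) hBm', lintegral_iInf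
          (f := fun N ω ↦ ∏ n ∈ Finset.range N, (1 + (if B n ω = true then a n else 0))⁻¹)
          (fun N ↦ (hpm N).comp hBm')
          (fun M N hMN ω ↦ antitone_prod_range (fun n ↦ hle n _) hMN) (by simp)]
    _ = _ := lintegral_congr fun b ↦ (hsec b).symm

end Fading

/-! ### Poisson means, the link distance and the path loss integral -/

lemma lintegral_poissonMeasure_natCast (r : NNReal) :
    ∫⁻ n, (n : ℝ≥0∞) ∂(poissonMeasure r) = r := by
  rw [poissonMeasure, lintegral_sum_measure]
  simp_rw [lintegral_smul_measure, lintegral_dirac, smul_eq_mul]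
  have h1 : HasSum (fun n : ℕ ↦ Real.exp (-r) * r ^ n / n.factorial) 1 :=
    hasSum_one_poissonMeasure r
  -- the term of index `n + 1` is `r` times the Poisson weight of `n`
  have hstep : ∀ n : ℕ, ENNReal.ofReal (Real.exp (-r) * r ^ (n + 1) / (n + 1).factorial)
      * ((n + 1 : ℕ) : ℝ≥0∞) = r * ENNReal.ofReal (Real.exp (-r) * r ^ n / n.factorial) := by
    intro n
    rw [← ENNReal.ofReal_natCast (n + 1), ← ENNReal.ofReal_coe_nnreal,
      ← ENNReal.ofReal_mul (by positivity), ← ENNReal.ofReal_mul (by positivity)]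
    congr 1
    rw [Nat.factorial_succ]
    push_cast
    field_simp
    ring
  rw [tsum_eq_zero_add' ENNReal.summable]
  simp_rw [hstep]
  rw [ENNReal.tsum_mul_left, ← ENNReal.ofReal_tsum_of_nonneg (fun n ↦ by positivity) h1.summable,
    h1.tsum_eq]
  simp

lemma lintegral_eq_of_map_eq_poissonMeasure {Ω : Type*} [MeasurableSpace Ω] {P : Measure Ω}
    {Y : Ω → ℝ≥0∞} (hY : Measurable Y) {r : NNReal}
    (h : P.map Y = (poissonMeasure r).map fun n : ℕ ↦ (n : ℝ≥0∞)) : ∫⁻ ω, Y ω ∂P = r := by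
  rw [← lintegral_poissonMeasure_natCast r, ← lintegral_map (f := fun x ↦ x) measurable_id hY, h,
    lintegral_map measurable_id' (by fun_prop)]

/-- The mean squared link distance. -/
lemma lintegral_sq_rayleighMeasure_one :
    ∫⁻ r, ENNReal.ofReal (r ^ 2) ∂(rayleighMeasure 1) = ENNReal.ofReal Real.pi⁻¹ := by
  have hint : ∫ x in Set.Ioi (0 : ℝ), x ^ (3 : ℝ) * Real.exp (-Real.pi * x ^ (2 : ℝ))
      = Real.pi ^ (-(3 + 1) / 2 : ℝ) * (1 / 2) * Real.Gamma ((3 + 1) / 2) :=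
    integral_rpow_mul_exp_neg_mul_rpow two_pos (by norm_num) Real.pi_pos
  have hval : Real.pi ^ (-(3 + 1) / 2 : ℝ) * (1 / 2) * Real.Gamma ((3 + 1) / 2)
      = (Real.pi ^ 2)⁻¹ / 2 := by
    rw [show (-(3 + 1) / 2 : ℝ) = -(2 : ℕ) by norm_num, Real.rpow_neg Real.pi_pos.le,
      Real.rpow_natCast, show ((3 + 1) / 2 : ℝ) = 1 + 1 by norm_num,
      Real.Gamma_add_one one_ne_zero, Real.Gamma_one]
    ring
  have hI : Integrable (fun x : ℝ ↦ x ^ (3 : ℝ) * Real.exp (-Real.pi * x ^ (2 : ℝ)))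
      (volume.restrict (Set.Ioi 0)) := by
    by_contra hno
    rw [integral_undef hno, hval] at hint
    have : 0 < (Real.pi ^ 2)⁻¹ / 2 := by positivity
    linarith
  have hm : Measurable fun a : ℝ ↦ ENNReal.ofReal (if 0 < a then
      2 * Real.pi * 1 * a * Real.exp (-(Real.pi * 1 * a ^ 2)) else 0) :=
    (Measurable.ite measurableSet_Ioi (by fun_prop) measurable_const).ennreal_ofReal
  rw [rayleighMeasure, lintegral_withDensity_eq_lintegral_mul _ hm (by fun_prop)]
  have hcongr : ∀ a : ℝ, ((fun a : ℝ ↦ ENNReal.ofReal (if 0 < a then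
      2 * Real.pi * 1 * a * Real.exp (-(Real.pi * 1 * a ^ 2)) else 0)) *
        fun r ↦ ENNReal.ofReal (r ^ 2)) a
      = (Set.Ioi 0).indicator (fun a ↦ ENNReal.ofReal (2 * Real.pi *
        (a ^ (3 : ℝ) * Real.exp (-Real.pi * a ^ (2 : ℝ))))) a := by
    intro a
    by_cases ha : 0 < a
    · rw [Set.indicator_of_mem (Set.mem_Ioi.2 ha), Pi.mul_apply, if_pos ha,
        ← ENNReal.ofReal_mul (by positivity)]
      congr 1
      rw [show (3 : ℝ) = (3 : ℕ) by norm_num, Real.rpow_natCast,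
        show (2 : ℝ) = (2 : ℕ) by norm_num, Real.rpow_natCast]
      push_cast
      ring_nf
    · rw [Set.indicator_of_notMem (by simpa using ha)]
      simp [ha]
  rw [lintegral_congr hcongr, lintegral_indicator measurableSet_Ioi,
    ← ofReal_integral_eq_lintegral_ofReal (hI.const_mul _) ?_, integral_const_mul, hint, hval]
  · congr 1
    field_simp
  · filter_upwards [ae_restrict_mem measurableSet_Ioi] with x hx
    have : (0 : ℝ) < x := hx
    positivity

/-- `∫ exp (-b ‖z‖ ^ α) dz` over the plane. -/
lemma lintegral_exp_neg_mul_norm_rpow {α b : ℝ} (hα : 1 ≤ α) (hb : 0 < b) :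
    ∫⁻ z : EuclideanSpace ℝ (Fin 2), ENNReal.ofReal (Real.exp (-b * ‖z‖ ^ α))
      = ENNReal.ofReal (Real.pi * b ^ (-2 / α) * Real.Gamma (2 / α + 1)) := by
  have hα0 : 0 < α := by linarith
  have hpos : 0 < Real.pi * b ^ (-2 / α) * Real.Gamma (2 / α + 1) := by
    have := Real.Gamma_pos_of_pos (s := 2 / α + 1) (by positivity)
    positivity
  have hint := Complex.integral_exp_neg_mul_rpow hα hb
  have hI : Integrable fun x : ℂ ↦ Real.exp (-b * ‖x‖ ^ α) := by
    by_contra hno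
    rw [integral_undef hno] at hint
    exact hpos.ne hint
  have hmp := Complex.orthonormalBasisOneI.measurePreserving_repr
  rw [← hmp.lintegral_comp (by fun_prop)]
  simp_rw [LinearIsometryEquiv.norm_map]
  rw [← ofReal_integral_eq_lintegral_ofReal hI (ae_of_all _ fun x ↦ (Real.exp_pos _).le), hint]

lemma lintegral_rpow_neg_expMeasure_one {d : ℝ} (hd : d < 1) :
    ∫⁻ x, ENNReal.ofReal (x ^ (-d)) ∂(expMeasure 1) = ENNReal.ofReal (Real.Gamma (1 - d)) := by
  have hpdf : Measurable (exponentialPDF 1) :=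
    (measurable_exponentialPDFReal 1).ennreal_ofReal
  rw [expMeasure_eq_withDensity, lintegral_withDensity_eq_lintegral_mul _ hpdf (by fun_prop)]
  have hcongr : (exponentialPDF 1 * fun x ↦ ENNReal.ofReal (x ^ (-d))) =ᵐ[volume]
      (Set.Ioi 0).indicator fun x ↦ ENNReal.ofReal (Real.exp (-x) * x ^ (1 - d - 1)) := by
    filter_upwards [Measure.ae_ne volume (0 : ℝ)] with x hx
    rcases lt_or_gt_of_ne hx with h | h
    · rw [Set.indicator_of_notMem (by simpa using h.le), Pi.mul_apply, exponentialPDF_of_neg h,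
        zero_mul]
    · rw [Set.indicator_of_mem (Set.mem_Ioi.2 h), Pi.mul_apply, exponentialPDF_of_nonneg h.le,
        ← ENNReal.ofReal_mul (by positivity)]
      ring_nf
  have hd' : 0 < 1 - d := by linarith
  rw [lintegral_congr_ae hcongr, lintegral_indicator measurableSet_Ioi,
    ← ofReal_integral_eq_lintegral_ofReal (Real.GammaIntegral_convergent hd') ?_,
    Real.Gamma_eq_integral hd']
  filter_upwards [ae_restrict_mem measurableSet_Ioi] with x hx
  have : (0 : ℝ) < x := hx
  positivity

lemma inv_ofReal_mul_enorm_rpow_neg {E : Type*} [NormedAddCommGroup E] {α C : ℝ} (hα : 0 < α)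
    (hC : 0 < C) (z : E) :
    (ENNReal.ofReal C * ‖z‖ₑ ^ (-α))⁻¹ = ENNReal.ofReal (‖z‖ ^ α / C) := by
  rw [ENNReal.mul_inv (Or.inl (by simpa using hC)) (Or.inl ENNReal.ofReal_ne_top),
    ENNReal.rpow_neg, inv_inv, ← ofReal_norm, ENNReal.ofReal_rpow_of_nonneg (norm_nonneg _) hα.le,
    ← ENNReal.ofReal_inv_of_pos hC, ← ENNReal.ofReal_mul (by positivity), mul_comm,
    div_eq_mul_inv]

/-- The total loss caused by a unit density of interferers; the integral is computed by writing
`1 / (1 + t)` as the Laplace transform of the standard exponential distribution at `t`. -/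
lemma lintegral_inv_one_add_inv_pathloss {α C : ℝ} (hα : 2 < α) (hC : 0 < C) :
    ∫⁻ z : EuclideanSpace ℝ (Fin 2), (1 + (ENNReal.ofReal C * ‖z‖ₑ ^ (-α))⁻¹)⁻¹
      = ENNReal.ofReal
        (Real.pi * C ^ (2 / α) * Real.Gamma (1 + 2 / α) * Real.Gamma (1 - 2 / α)) := by
  have hα0 : 0 < α := by linarith
  have hδ : 2 / α < 1 := by rw [div_lt_one hα0]; exact hα
  have hG : 0 < Real.Gamma (2 / α + 1) := Real.Gamma_pos_of_pos (by positivity)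
  have : IsProbabilityMeasure (expMeasure 1) := isProbabilityMeasure_expMeasure one_pos
  simp_rw [inv_ofReal_mul_enorm_rpow_neg hα0 hC, ← lintegral_expNeg_expMeasure_one]
  have hjoint : Measurable fun w : EuclideanSpace ℝ (Fin 2) × ℝ ↦
      expNeg (ENNReal.ofReal w.2 * ENNReal.ofReal (‖w.1‖ ^ α / C)) :=
    measurable_expNeg.comp (by fun_prop)
  rw [lintegral_lintegral_swap hjoint.aemeasurable]
  have hinner : (fun x ↦ ∫⁻ z : EuclideanSpace ℝ (Fin 2),
      expNeg (ENNReal.ofReal x * ENNReal.ofReal (‖z‖ ^ α / C))) =ᵐ[expMeasure 1]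
      fun x ↦ ENNReal.ofReal (Real.pi * C ^ (2 / α) * Real.Gamma (2 / α + 1))
        * ENNReal.ofReal (x ^ (-(2 / α))) := by
    have hpos : ∀ᵐ x ∂(expMeasure 1), 0 < x := by
      have h := expMeasure_one_setOf_lt_ofReal 0
      rw [expNeg_zero] at h
      simp only [ENNReal.ofReal_pos] at h
      exact (mem_ae_iff_prob_eq_one measurableSet_Ioi).2 h
    filter_upwards [hpos] with x hx
    have h1 : ∀ z : EuclideanSpace ℝ (Fin 2),
        expNeg (ENNReal.ofReal x * ENNReal.ofReal (‖z‖ ^ α / C))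
          = ENNReal.ofReal (Real.exp (-(x / C) * ‖z‖ ^ α)) := by
      intro z
      rw [← ENNReal.ofReal_mul hx.le, expNeg_ofReal (by positivity)]
      ring_nf
    rw [lintegral_congr h1, lintegral_exp_neg_mul_norm_rpow (by linarith) (by positivity),
      ← ENNReal.ofReal_mul (by positivity)]
    congr 1
    rw [neg_div, Real.div_rpow hx.le hC.le, Real.rpow_neg hC.le]
    field_simp
  rw [lintegral_congr_ae hinner, lintegral_const_mul _ (by fun_prop),
    lintegral_rpow_neg_expMeasure_one hδ, ← ENNReal.ofReal_mul (by positivity), add_comm (2 / α)]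

/-! ### The loss sum as a function of the geometry -/

lemma measurable_pointConfiguration : Measurable pointConfiguration := by
  refine Measure.measurable_of_measurable_coe _ fun s hs ↦ ?_
  simp_rw [pointConfiguration, Measure.sum_apply _ hs, Measure.dirac_apply' _ hs]
  exact Measurable.tsum fun n ↦ (measurable_one.indicator hs).comp (measurable_pi_apply n)

lemma lintegral_pointConfiguration (x : ℕ → EuclideanSpace ℝ (Fin 2))
    {f : EuclideanSpace ℝ (Fin 2) → ℝ≥0∞} (hf : Measurable f) :
    ∫⁻ z, f z ∂(pointConfiguration x) = ∑' n, f (x n) := by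
  rw [pointConfiguration, lintegral_sum_measure]
  exact tsum_congr fun n ↦ lintegral_dirac' _ hf

/-- `a / (1 + a)` for the relative received power `a = θ r ^ α / ‖z‖ ^ α` of an interferer at `z`
when the link distance is `r`: the loss in success probability that it causes when active.
It is meant for `0 < r`. At `z = 0` it has the correct value `1`, as `0 ^ α = 0` for
`α ≠ 0`. -/
noncomputable def lossFactor (α θ r : ℝ) (z : EuclideanSpace ℝ (Fin 2)) : ℝ≥0∞ :=
  (1 + ENNReal.ofReal (‖z‖ ^ α / (θ * r ^ α)))⁻¹

lemma measurable_lossFactor (α θ r : ℝ) : Measurable (lossFactor α θ r) := by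
  unfold lossFactor
  fun_prop

lemma lossFactor_mono {α θ q r : ℝ} (hα : 0 < α) (hθ : 0 < θ) (hq : 0 < q) (hqr : q ≤ r)
    (z : EuclideanSpace ℝ (Fin 2)) : lossFactor α θ q z ≤ lossFactor α θ r z := by
  unfold lossFactor
  gcongr

lemma continuousAt_lossFactor {α θ r : ℝ} (hθ : 0 < θ) (hr : 0 < r)
    (z : EuclideanSpace ℝ (Fin 2)) : ContinuousAt (fun r ↦ lossFactor α θ r z) r := by
  unfold lossFactor
  refine continuous_inv.continuousAt.comp (f := fun r : ℝ ↦
    1 + ENNReal.ofReal (‖z‖ ^ α / (θ * r ^ α))) (ContinuousAt.add continuousAt_const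
      (ENNReal.continuous_ofReal.continuousAt.comp (f := fun r : ℝ ↦ ‖z‖ ^ α / (θ * r ^ α)) ?_))
  have h : ContinuousAt (fun r : ℝ ↦ r ^ α) r := Real.continuousAt_rpow_const _ _ (Or.inl hr.ne')
  exact continuousAt_const.div (continuousAt_const.mul h) (by positivity)

/-- The sum of the loss factors over the points of `φ`, for the link distance `r`. It is written
as a supremum over rational distances, which makes it jointly measurable in `(φ, r)` although `φ`
ranges over arbitrary measures; see `lossSum_eq_lintegral`. -/
noncomputable def lossSum (α θ : ℝ) (w : Measure (EuclideanSpace ℝ (Fin 2)) × ℝ) : ℝ≥0∞ :=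
  ⨆ q : ℚ, if 0 < (q : ℝ) ∧ (q : ℝ) < w.2 then ∫⁻ z, lossFactor α θ q z ∂w.1 else 0

lemma measurable_lossSum (α θ : ℝ) : Measurable (lossSum α θ) := by
  refine Measurable.iSup fun q ↦ Measurable.ite ?_ ?_ measurable_const
  · exact (MeasurableSet.const _).inter (measurableSet_lt measurable_const measurable_snd)
  · exact (Measure.measurable_lintegral (measurable_lossFactor α θ q)).comp measurable_fst

lemma lossSum_eq_lintegral {α θ : ℝ} (hα : 0 < α) (hθ : 0 < θ)
    (φ : Measure (EuclideanSpace ℝ (Fin 2))) {r : ℝ} (hr : 0 < r) :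
    lossSum α θ (φ, r) = ∫⁻ z, lossFactor α θ r z ∂φ := by
  have hsup : ∀ z, lossFactor α θ r z
      = ⨆ q : ℚ, if 0 < (q : ℝ) ∧ (q : ℝ) < r then lossFactor α θ q z else 0 := by
    intro z
    -- the loss factor is increasing and continuous in the link distance
    refine le_antisymm (le_of_forall_lt fun c hc ↦ ?_) (iSup_le fun q ↦ ?_)
    · have hev := (continuousAt_lossFactor (α := α) hθ hr z).eventually (lt_mem_nhds hc)
      obtain ⟨l, u, ⟨hl, hu⟩, hlu⟩ := mem_nhds_iff_exists_Ioo_subset.1 hev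
      obtain ⟨q, hq1, hq2⟩ := exists_rat_btwn (max_lt hl hr)
      rw [lt_iSup_iff]
      refine ⟨q, ?_⟩
      rw [if_pos ⟨(le_max_right _ _).trans_lt hq1, hq2⟩]
      exact hlu ⟨(le_max_left _ _).trans_lt hq1, hq2.trans hu⟩
    · split_ifs with h
      · exact lossFactor_mono hα hθ h.1 h.2.le z
      · exact zero_le
  simp_rw [hsup]
  rw [lintegral_iSup_directed]
  · refine iSup_congr fun q ↦ ?_
    split_ifs <;> simp
  · intro q
    split_ifs
    · exact (measurable_lossFactor α θ q).aemeasurable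
    · exact aemeasurable_const
  · intro q q'
    by_cases h : 0 < (q : ℝ) ∧ (q : ℝ) < r
    · by_cases h' : 0 < (q' : ℝ) ∧ (q' : ℝ) < r
      · have hm : 0 < ((max q q' : ℚ) : ℝ) ∧ ((max q q' : ℚ) : ℝ) < r := by
          rcases max_choice q q' with e | e <;> rw [e] <;> assumption
        refine ⟨max q q', fun z ↦ ?_, fun z ↦ ?_⟩
        · simp only [if_pos h, if_pos hm]
          exact lossFactor_mono hα hθ h.1 (by exact_mod_cast le_max_left q q') z
        · simp only [if_pos h', if_pos hm]
          exact lossFactor_mono hα hθ h'.1 (by exact_mod_cast le_max_right q q') z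
      · exact ⟨q, le_rfl, fun z ↦ by simp only [if_neg h']; exact zero_le⟩
    · exact ⟨q', fun z ↦ by simp only [if_neg h]; exact zero_le, le_rfl⟩

/-! ### Conditional probabilities -/

/-- If `P (G' ∩ S) > c P G'` for all non-null `m`-measurable `G' ⊆ G`, then the conditional
probability of `S` given `m` exceeds `c` almost surely on `G`. -/
lemma ae_lt_condExp_indicator_of_forall_lt {Ω : Type*} {m m0 : MeasurableSpace Ω}
    {P : Measure Ω} [IsProbabilityMeasure P] (hm : m ≤ m0) {S G : Set Ω} (hS : MeasurableSet S)
    (hG : MeasurableSet[m] G) {c : ℝ}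
    (h : ∀ G' ⊆ G, MeasurableSet[m] G' → P G' ≠ 0 → c * P.real G' < P.real (S ∩ G')) :
    ∀ᵐ ω ∂P, ω ∈ G → c < (P[S.indicator (fun _ ↦ (1 : ℝ)) | m]) ω := by
  set f : Ω → ℝ := P[S.indicator (fun _ ↦ (1 : ℝ)) | m]
  have hfm : Measurable[m] f := stronglyMeasurable_condExp.measurable
  have hG' : MeasurableSet[m] (G ∩ {ω | f ω ≤ c}) :=
    hG.inter (@measurableSet_le _ _ _ _ _ m _ _ _ _ _ hfm measurable_const)
  have hnull : P (G ∩ {ω | f ω ≤ c}) = 0 := by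
    by_contra hne
    have h1 := h _ Set.inter_subset_left hG' hne
    have h2 : ∫ ω in G ∩ {ω | f ω ≤ c}, f ω ∂P = P.real (S ∩ (G ∩ {ω | f ω ≤ c})) := by
      rw [setIntegral_condExp hm ((integrable_const 1).indicator hS) hG', integral_indicator hS,
        setIntegral_const, measureReal_restrict_apply hS]
      simp
    have h3 : ∫ ω in G ∩ {ω | f ω ≤ c}, f ω ∂P ≤ ∫ _ in G ∩ {ω | f ω ≤ c}, c ∂P :=
      setIntegral_mono_on integrable_condExp.integrableOn (integrable_const c).integrableOn
        (hm _ hG') fun ω hω ↦ hω.2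
    rw [setIntegral_const, smul_eq_mul] at h3
    linarith
  rw [measure_eq_zero_iff_ae_notMem] at hnull
  filter_upwards [hnull] with ω hω hωG
  by_contra hle
  exact hω ⟨hωG, not_lt.1 hle⟩

namespace RayleighBipolarNetwork

variable {lam mu p : ℝ} (N : RayleighBipolarNetwork.{u} lam mu p)

/-! ### Laws of the network -/

lemma measurable_X_pi : Measurable fun ω n ↦ N.X n ω := measurable_pi_lambda _ N.measurable_X

lemma measurable_B_pi : Measurable fun ω n ↦ N.B n ω := measurable_pi_lambda _ N.measurable_B

lemma measurable_h_pi : Measurable fun ω i ↦ N.h i ω := measurable_pi_lambda _ N.measurable_h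

lemma measurable_Phi_R : Measurable fun ω ↦ (N.Phi ω, N.R ω) :=
  (measurable_pointConfiguration.comp N.measurable_X_pi).prodMk N.measurable_R

lemma geometry_le : N.geometry ≤ N.mΩ := N.measurable_Phi_R.comap_le

lemma ae_R_pos : ∀ᵐ ω ∂N.P, 0 < N.R ω := by
  have h : ∀ᵐ r ∂(N.P.map N.R), 0 < r := by
    have hm : Measurable fun a : ℝ ↦ ENNReal.ofReal (if 0 < a then
        2 * Real.pi * mu * a * Real.exp (-(Real.pi * mu * a ^ 2)) else 0) :=
      (Measurable.ite measurableSet_Ioi (by fun_prop) measurable_const).ennreal_ofReal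
    rw [N.law_R, rayleighMeasure, ae_withDensity_iff hm]
    refine ae_of_all _ fun r hr ↦ ?_
    by_contra hneg
    simp [hneg] at hr
  exact ae_of_ae_map N.measurable_R.aemeasurable h

/-- The intensity measure of the interferers is `lam` times the Lebesgue measure. -/
lemma sum_map_X_eq : (Measure.sum fun n ↦ N.P.map (N.X n))
    = ENNReal.ofReal lam • (volume : Measure (EuclideanSpace ℝ (Fin 2))) := by
  have hfin : ∀ A : Set (EuclideanSpace ℝ (Fin 2)), MeasurableSet A → volume A ≠ ⊤ →
      (Measure.sum fun n ↦ N.P.map (N.X n)) A = ENNReal.ofReal lam * volume A := by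
    intro A hA hvol
    have hΛ : (ENNReal.ofReal lam • (volume : Measure (EuclideanSpace ℝ (Fin 2)))) A ≠ ⊤ :=
      ENNReal.mul_ne_top ENNReal.ofReal_ne_top hvol
    have h := lintegral_eq_of_map_eq_poissonMeasure ((Measure.measurable_coe hA).comp N.poisson.measurable)
      (N.poisson.law_count A hA hΛ)
    rw [ENNReal.coe_toNNReal hΛ] at h
    change _ = ENNReal.ofReal lam * volume A at h
    rw [← h, Measure.sum_apply _ hA]
    simp_rw [Function.comp_apply, pointConfiguration, Measure.sum_apply _ hA,
      Measure.dirac_apply' _ hA]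
    rw [lintegral_tsum (f := fun n ω ↦ A.indicator 1 (N.X n ω)) fun n ↦
      ((measurable_one.indicator hA).comp (N.measurable_X n)).aemeasurable]
    refine tsum_congr fun n ↦ ?_
    rw [← lintegral_map (measurable_one.indicator hA) (N.measurable_X n), lintegral_indicator_one hA]
  refine (Measure.ext_iff_of_iUnion_eq_univ (s := spanningSets volume)
    (iUnion_spanningSets volume)).2 fun i ↦ Measure.ext fun A hA ↦ ?_
  rw [Measure.restrict_apply hA, Measure.restrict_apply hA]
  refine hfin _ (hA.inter (measurableSet_spanningSets _ i)) ?_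
  exact ((measure_mono Set.inter_subset_right).trans_lt (measure_spanningSets_lt_top _ i)).ne

/-- Campbell's formula for the interferers. -/
lemma lintegral_tsum_X {f : EuclideanSpace ℝ (Fin 2) → ℝ≥0∞} (hf : Measurable f) :
    ∫⁻ x : ℕ → EuclideanSpace ℝ (Fin 2), ∑' n, f (x n) ∂(N.P.map fun ω n ↦ N.X n ω)
      = ENNReal.ofReal lam * ∫⁻ z, f z := by
  rw [← smul_eq_mul, ← lintegral_smul_measure, ← N.sum_map_X_eq, lintegral_sum_measure,
    lintegral_map (by fun_prop) N.measurable_X_pi, lintegral_tsum (f := fun n ω ↦ f (N.X n ω)) fun n ↦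
      (hf.comp (N.measurable_X n)).aemeasurable]
  exact tsum_congr fun n ↦ (lintegral_map hf (N.measurable_X n)).symm

lemma indepFun_X_R : IndepFun (fun ω n ↦ N.X n ω) N.R N.P :=
  N.indep_X_rest.comp (φ := id) (ψ := Prod.fst) measurable_id measurable_fst

lemma map_X_R : N.P.map (fun ω ↦ ((fun n ↦ N.X n ω), N.R ω))
    = (N.P.map fun ω n ↦ N.X n ω).prod (N.P.map N.R) :=
  (indepFun_iff_map_prod_eq_prod_map_map N.measurable_X_pi.aemeasurable
    N.measurable_R.aemeasurable).1 N.indepFun_X_R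

/-- The locations and the link distance are independent of the marks, whose two components are
independent of each other. -/
lemma map_geometry_marks :
    N.P.map (fun ω ↦ (((fun n ↦ N.X n ω), N.R ω), ((fun n ↦ N.B n ω), fun i ↦ N.h i ω)))
      = (N.P.map fun ω ↦ ((fun n ↦ N.X n ω), N.R ω)).prod
          ((N.P.map fun ω n ↦ N.B n ω).prod (N.P.map fun ω i ↦ N.h i ω)) := by
  have hX := N.measurable_X_pi
  have hR := N.measurable_R
  have hBh := N.measurable_B_pi.prodMk N.measurable_h_pi
  have h1 := (indepFun_iff_map_prod_eq_prod_map_map N.measurable_B_pi.aemeasurable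
    N.measurable_h_pi.aemeasurable).1 N.indep_B_h
  have h2 := (indepFun_iff_map_prod_eq_prod_map_map hR.aemeasurable
    hBh.aemeasurable).1 N.indep_R_marks
  have h3 := (indepFun_iff_map_prod_eq_prod_map_map hX.aemeasurable
    (hR.prodMk hBh).aemeasurable).1 N.indep_X_rest
  have : IsProbabilityMeasure (N.P.map fun ω n ↦ N.X n ω) :=
    Measure.isProbabilityMeasure_map hX.aemeasurable
  have : IsProbabilityMeasure (N.P.map N.R) := Measure.isProbabilityMeasure_map hR.aemeasurable
  rw [h2, ← Measure.prodAssoc_prod, ← N.map_X_R, h1] at h3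
  have h4 := congrArg (Measure.map MeasurableEquiv.prodAssoc.symm) h3
  rw [Measure.map_map (MeasurableEquiv.measurable _) (MeasurableEquiv.measurable _),
    MeasurableEquiv.symm_comp_self, Measure.map_id,
    Measure.map_map (MeasurableEquiv.measurable _) (hX.prodMk (hR.prodMk hBh))] at h4
  exact h4

lemma lossSum_pointConfiguration {α θ : ℝ} (hα : 0 < α) (hθ : 0 < θ)
    (x : ℕ → EuclideanSpace ℝ (Fin 2)) {r : ℝ} (hr : 0 < r) :
    lossSum α θ (pointConfiguration x, r) = ∑' n, lossFactor α θ r (x n) := by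
  rw [lossSum_eq_lintegral hα hθ _ hr, lintegral_pointConfiguration _ (measurable_lossFactor α θ r)]

/-- The mean loss sum: given `R` it is `lam π R² θ ^ δ Γ(1 + δ) Γ(1 - δ)` by Campbell's formula,
and `E[R²] = 1 / π`. -/
lemma lintegral_lossSum (N : RayleighBipolarNetwork.{u} lam 1 p) {α θ : ℝ} (hα : 2 < α)
    (hθ : 0 < θ) :
    ∫⁻ ω, lossSum α θ (N.Phi ω, N.R ω) ∂N.P = ENNReal.ofReal lam * ENNReal.ofReal
      (θ ^ (2 / α) * Real.Gamma (1 + 2 / α) * Real.Gamma (1 - 2 / α)) := by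
  have hα0 : 0 < α := by linarith
  have hδ : 0 < 1 - 2 / α := by rw [sub_pos, div_lt_one hα0]; exact hα
  have hG1 : 0 < Real.Gamma (1 + 2 / α) := Real.Gamma_pos_of_pos (by positivity)
  have hG2 : 0 < Real.Gamma (1 - 2 / α) := Real.Gamma_pos_of_pos hδ
  have hm : Measurable fun u : (ℕ → EuclideanSpace ℝ (Fin 2)) × ℝ ↦
      lossSum α θ (pointConfiguration u.1, u.2) :=
    (measurable_lossSum α θ).comp
      ((measurable_pointConfiguration.comp measurable_fst).prodMk measurable_snd)
  have hmap := lintegral_map (μ := N.P) hm (N.measurable_X_pi.prodMk N.measurable_R)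
  change _ = ∫⁻ ω, lossSum α θ (N.Phi ω, N.R ω) ∂N.P at hmap
  have hpos : ∀ᵐ r ∂(N.P.map N.R), 0 < r :=
    (ae_map_iff N.measurable_R.aemeasurable measurableSet_Ioi).2 N.ae_R_pos
  rw [← hmap, N.map_X_R, lintegral_prod_symm' _ hm]
  calc _ = ∫⁻ r, ENNReal.ofReal lam * ENNReal.ofReal (Real.pi * θ ^ (2 / α) *
          Real.Gamma (1 + 2 / α) * Real.Gamma (1 - 2 / α)) * ENNReal.ofReal (r ^ 2)
          ∂(N.P.map N.R) := by
        refine lintegral_congr_ae ?_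
        filter_upwards [hpos] with r hr
        have hC : 0 < θ * r ^ α := by positivity
        have hf : lossFactor α θ r = fun z ↦
            (1 + (ENNReal.ofReal (θ * r ^ α) * ‖z‖ₑ ^ (-α))⁻¹)⁻¹ := by
          funext z
          rw [inv_ofReal_mul_enorm_rpow_neg hα0 hC, lossFactor]
        simp_rw [lossSum_pointConfiguration hα0 hθ _ hr]
        rw [N.lintegral_tsum_X (measurable_lossFactor α θ r), hf,
          lintegral_inv_one_add_inv_pathloss hα hC, mul_assoc (ENNReal.ofReal lam)]
        congr 1
        rw [← ENNReal.ofReal_mul (by positivity), Real.mul_rpow hθ.le (by positivity),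
          ← Real.rpow_mul hr.le,
          mul_div_cancel₀ _ hα0.ne', Real.rpow_two]
        ring_nf
    _ = _ := by
        rw [lintegral_const_mul _ (by fun_prop), N.law_R, lintegral_sq_rayleighMeasure_one,
          mul_assoc]
        congr 1
        rw [← ENNReal.ofReal_mul (by positivity)]
        congr 1
        field_simp

/-- The event `SIR > θ` without divisions, at a positive link distance. An infinite interference
fails the hypothesis, and an interference `0` is covered, with `SIR = ∞`. -/
lemma lt_SIR {α θ : ℝ} (hθ : 0 < θ) {ω : N.Ω} (hR : 0 < N.R ω)
    (h : ∑' n, (if N.B n ω = true then ENNReal.ofReal (N.h (some n) ω)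
        * (ENNReal.ofReal (θ * N.R ω ^ α) * ‖N.X n ω‖ₑ ^ (-α)) else 0)
      < ENNReal.ofReal (N.h none ω)) : ENNReal.ofReal θ < N.SIR α ω := by
  have hC : 0 < θ * N.R ω ^ α := by positivity
  have hsum : ∑' n, (if N.B n ω = true then ENNReal.ofReal (N.h (some n) ω)
        * (ENNReal.ofReal (θ * N.R ω ^ α) * ‖N.X n ω‖ₑ ^ (-α)) else 0)
      = ENNReal.ofReal (θ * N.R ω ^ α) * N.interference α ω := by
    rw [interference, ← ENNReal.tsum_mul_left]
    refine tsum_congr fun n ↦ ?_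
    split_ifs
    · ring
    · simp
  rw [hsum] at h
  have hRα : ENNReal.ofReal (N.R ω) ^ (-α) = (ENNReal.ofReal (N.R ω ^ α))⁻¹ := by
    rw [ENNReal.rpow_neg, ENNReal.ofReal_rpow_of_pos hR]
  have hne0 : ENNReal.ofReal (N.R ω ^ α) ≠ 0 := by simpa using Real.rpow_pos_of_pos hR α
  rw [SIR, hRα, ENNReal.lt_div_iff_mul_lt, ← div_eq_mul_inv, ENNReal.lt_div_iff_mul_lt]
  · rw [ENNReal.ofReal_mul hθ.le] at h
    calc _ = _ := by ring
      _ < _ := h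
  · exact Or.inl hne0
  · exact Or.inl ENNReal.ofReal_ne_top
  · refine Or.inr ENNReal.ofReal_ne_top
  · refine Or.inr (by simpa using hθ)

lemma measurable_interference (α : ℝ) : Measurable (N.interference α) := by
  have hX := N.measurable_X
  have hh := N.measurable_h
  refine Measurable.tsum fun n ↦ Measurable.ite
    (measurableSet_eq_fun (N.measurable_B n) measurable_const) ?_ measurable_const
  exact (hh _).ennreal_ofReal.mul ((hX n).enorm.pow_const _)

lemma measurableSet_lt_SIR (α θ : ℝ) : MeasurableSet {ω | ENNReal.ofReal θ < N.SIR α ω} := by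
  refine measurableSet_lt measurable_const (Measurable.div ?_ (N.measurable_interference α))
  exact (N.measurable_h none).ennreal_ofReal.mul (N.measurable_R.ennreal_ofReal.pow_const _)

/-- Integrated over any event of the geometry, the success probability is at least
`exp (-(p / (1 - p)) * lossSum)`. -/
lemma setLIntegral_expNeg_lossSum_le {α θ : ℝ} (hα : 0 < α) (hθ : 0 < θ) (hp : 0 < p)
    (hp1 : p < 1) {S : Set (Measure (EuclideanSpace ℝ (Fin 2)) × ℝ)} (hS : MeasurableSet S) :
    ∫⁻ ω in (fun ω ↦ (N.Phi ω, N.R ω)) ⁻¹' S,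
        expNeg (ENNReal.ofReal (p / (1 - p)) * lossSum α θ (N.Phi ω, N.R ω)) ∂N.P
      ≤ N.P ({ω | ENNReal.ofReal θ < N.SIR α ω} ∩ (fun ω ↦ (N.Phi ω, N.R ω)) ⁻¹' S) := by
  set U : N.Ω → (ℕ → EuclideanSpace ℝ (Fin 2)) × ℝ := fun ω ↦ ((fun n ↦ N.X n ω), N.R ω)
  set V : N.Ω → (ℕ → Bool) × (Option ℕ → ℝ) := fun ω ↦ ((fun n ↦ N.B n ω), fun i ↦ N.h i ω)
  have hUm : Measurable U := N.measurable_X_pi.prodMk N.measurable_R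
  have hVm : Measurable V := N.measurable_B_pi.prodMk N.measurable_h_pi
  let c : (ℕ → EuclideanSpace ℝ (Fin 2)) × ℝ → Measure (EuclideanSpace ℝ (Fin 2)) × ℝ :=
    fun u ↦ (pointConfiguration u.1, u.2)
  have hc : Measurable c := (measurable_pointConfiguration.comp measurable_fst).prodMk measurable_snd
  let W : Set (((ℕ → EuclideanSpace ℝ (Fin 2)) × ℝ) × ((ℕ → Bool) × (Option ℕ → ℝ))) :=
    {w | ∑' n, (if w.2.1 n = true then ENNReal.ofReal (w.2.2 (some n))
        * (ENNReal.ofReal (θ * w.1.2 ^ α) * ‖w.1.1 n‖ₑ ^ (-α)) else 0)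
      < ENNReal.ofReal (w.2.2 none)}
  have hW : MeasurableSet W := by
    refine measurableSet_lt (Measurable.tsum fun n ↦ Measurable.ite ?_ (by fun_prop)
      measurable_const) (by fun_prop)
    exact measurableSet_eq_fun (by fun_prop) measurable_const
  have hpos : ∀ᵐ u ∂(N.P.map U), 0 < u.2 :=
    (ae_map_iff hUm.aemeasurable (measurableSet_lt measurable_const measurable_snd)).2 N.ae_R_pos
  have hsets : MeasurableSet (W ∩ Prod.fst ⁻¹' (c ⁻¹' S)) := hW.inter (measurable_fst (hc hS))
  set ν := (N.P.map fun ω n ↦ N.B n ω).prod (N.P.map fun ω i ↦ N.h i ω)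
  have : IsProbabilityMeasure (N.P.map fun ω n ↦ N.B n ω) :=
    Measure.isProbabilityMeasure_map N.measurable_B_pi.aemeasurable
  have : IsProbabilityMeasure (N.P.map fun ω i ↦ N.h i ω) :=
    Measure.isProbabilityMeasure_map N.measurable_h_pi.aemeasurable
  calc _ = ∫⁻ u in c ⁻¹' S, expNeg (ENNReal.ofReal (p / (1 - p)) * lossSum α θ (c u))
          ∂(N.P.map U) := by
        rw [setLIntegral_map (f := fun u ↦ expNeg (ENNReal.ofReal (p / (1 - p)) * lossSum α θ (c u)))
          (hc hS) (measurable_expNeg.comp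
          (((measurable_lossSum α θ).comp hc).const_mul _)) hUm]
        rfl
    _ ≤ ∫⁻ u in c ⁻¹' S, ν (Prod.mk u ⁻¹' W) ∂(N.P.map U) := by
        refine lintegral_mono_ae (ae_restrict_of_ae ?_)
        filter_upwards [hpos] with u hu
        have hC : 0 < θ * u.2 ^ α := by positivity
        refine le_trans (le_of_eq ?_) (expNeg_le_prod_measure_tsum_ite_lt hp hp1 N.measurable_B
          N.indep_B N.law_B N.measurable_h N.indep_h N.law_h
          fun n ↦ ENNReal.ofReal (θ * u.2 ^ α) * ‖u.1 n‖ₑ ^ (-α))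
        simp_rw [inv_ofReal_mul_enorm_rpow_neg hα hC]
        rw [lossSum_pointConfiguration hα hθ _ hu]
        rfl
    _ = (N.P.map fun ω ↦ (U ω, V ω)) (W ∩ Prod.fst ⁻¹' (c ⁻¹' S)) := by
        rw [N.map_geometry_marks, Measure.prod_apply hsets, ← lintegral_indicator (hc hS)]
        refine lintegral_congr fun u ↦ ?_
        by_cases hu : u ∈ c ⁻¹' S
        · rw [Set.indicator_of_mem hu]
          congr 1
          ext v
          exact ⟨fun hv ↦ ⟨hv, hu⟩, fun hv ↦ hv.1⟩
        · rw [Set.indicator_of_notMem hu]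
          have hempty : Prod.mk u ⁻¹' (W ∩ Prod.fst ⁻¹' (c ⁻¹' S)) = ∅ :=
            Set.eq_empty_of_forall_notMem fun v hv ↦ hu hv.2
          rw [hempty, measure_empty]
    _ = N.P ((fun ω ↦ (U ω, V ω)) ⁻¹' (W ∩ Prod.fst ⁻¹' (c ⁻¹' S))) :=
        Measure.map_apply (hUm.prodMk hVm) hsets
    _ ≤ _ := by
        refine measure_mono_ae ?_
        filter_upwards [N.ae_R_pos] with ω hR hω
        exact ⟨N.lt_SIR hθ hR hω.1, hω.2⟩

/-! ### Reliable links -/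

/-- A link is almost surely reliable if its loss sum is small enough. -/
lemma ae_lt_successProb {α θ ε : ℝ} (hα : 0 < α) (hθ : 0 < θ) (hp : 0 < p) (hp1 : p < 1)
    (hε1 : ε < 1) :
    ∀ᵐ ω ∂N.P, ENNReal.ofReal (1 - ε)
        < expNeg (ENNReal.ofReal (p / (1 - p)) * lossSum α θ (N.Phi ω, N.R ω)) →
      1 - ε < N.successProb α θ ω := by
  set g : Measure (EuclideanSpace ℝ (Fin 2)) × ℝ → ℝ≥0∞ := fun w ↦
    expNeg (ENNReal.ofReal (p / (1 - p)) * lossSum α θ w)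
  have hgm : Measurable g := measurable_expNeg.comp ((measurable_lossSum α θ).const_mul _)
  have hS : MeasurableSet {w | ENNReal.ofReal (1 - ε) < g w} :=
    measurableSet_lt measurable_const hgm
  have hε : 0 < 1 - ε := by linarith
  refine ae_lt_condExp_indicator_of_forall_lt N.geometry_le (N.measurableSet_lt_SIR α θ)
    (G := (fun ω ↦ (N.Phi ω, N.R ω)) ⁻¹' {w | ENNReal.ofReal (1 - ε) < g w}) ⟨_, hS, rfl⟩ ?_
  rintro _ hsub ⟨S, hSm, rfl⟩ hne
  have hlt : ENNReal.ofReal (1 - ε) * N.P ((fun ω ↦ (N.Phi ω, N.R ω)) ⁻¹' S)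
      < ∫⁻ ω in (fun ω ↦ (N.Phi ω, N.R ω)) ⁻¹' S, g (N.Phi ω, N.R ω) ∂N.P := by
    rw [← setLIntegral_const]
    refine setLIntegral_strict_mono (N.measurable_Phi_R hSm) hne (hgm.comp N.measurable_Phi_R) ?_
      (ae_of_all _ fun ω hω ↦ hsub hω)
    rw [setLIntegral_const]
    exact ENNReal.mul_ne_top ENNReal.ofReal_ne_top (measure_ne_top _ _)
  have h := hlt.trans_le (N.setLIntegral_expNeg_lossSum_le hα hθ hp hp1 hSm)
  rw [← ofReal_measureReal, ← ofReal_measureReal, ← ENNReal.ofReal_mul hε.le] at h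
  exact (ENNReal.ofReal_lt_ofReal_iff_of_nonneg (by positivity)).1 h

/-- Markov's inequality for the loss sum bounds the fraction of unreliable links. -/
lemma one_sub_le_eta (N : RayleighBipolarNetwork.{u} lam 1 p) {α θ ε : ℝ} (hα : 2 < α)
    (hθ : 0 < θ) (hε0 : 0 < ε) (hε1 : ε < 1) (hlam : 0 < lam) (hp : 0 < p) (hp1 : p < 1) :
    1 - lam * p * (θ ^ (2 / α) * Real.Gamma (1 + 2 / α) * Real.Gamma (1 - 2 / α))
        / ((1 - p) * -Real.log (1 - ε)) ≤ N.eta α θ ε := by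
  set K := θ ^ (2 / α) * Real.Gamma (1 + 2 / α) * Real.Gamma (1 - 2 / α)
  set L := -Real.log (1 - ε) with hL
  have hα0 : 0 < α := by linarith
  have hε : 0 < 1 - ε := by linarith
  have hL0 : 0 < L := neg_pos.2 (Real.log_neg hε (by linarith))
  have hq : 0 < 1 - p := by linarith
  have hκ : 0 < p / (1 - p) := by positivity
  set Y : N.Ω → ℝ≥0∞ := fun ω ↦ ENNReal.ofReal (p / (1 - p)) * lossSum α θ (N.Phi ω, N.R ω)
  have hlossm : Measurable fun ω ↦ lossSum α θ (N.Phi ω, N.R ω) :=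
    (measurable_lossSum α θ).comp N.measurable_Phi_R
  have hYm : Measurable Y := hlossm.const_mul _
  have hY : ∫⁻ ω, Y ω ∂N.P = ENNReal.ofReal (p / (1 - p) * (lam * K)) := by
    rw [lintegral_const_mul _ hlossm, N.lintegral_lossSum hα hθ, ← ENNReal.ofReal_mul hlam.le,
      ← ENNReal.ofReal_mul hκ.le]
  have hmarkov : N.P.real {ω | ENNReal.ofReal L ≤ Y ω} ≤ p / (1 - p) * (lam * K) / L := by
    have h := mul_meas_ge_le_lintegral (μ := N.P) hYm (ENNReal.ofReal L)
    rw [hY, ← ofReal_measureReal, ← ENNReal.ofReal_mul hL0.le] at h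
    have hK : 0 ≤ p / (1 - p) * (lam * K) := by
      have hδ : 0 < 1 - 2 / α := by rw [sub_pos, div_lt_one hα0]; exact hα
      have hG1 : 0 < Real.Gamma (1 + 2 / α) := Real.Gamma_pos_of_pos (by positivity)
      have hG2 : 0 < Real.Gamma (1 - 2 / α) := Real.Gamma_pos_of_pos hδ
      positivity
    rw [le_div_iff₀ hL0, mul_comm]
    exact (ENNReal.ofReal_le_ofReal_iff hK).1 h
  have hset : MeasurableSet {ω | ENNReal.ofReal L ≤ Y ω} := measurableSet_le measurable_const hYm
  have hle : N.P.real {ω | ENNReal.ofReal L ≤ Y ω}ᶜ ≤ N.eta α θ ε := by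
    refine ENNReal.toReal_mono (measure_ne_top _ _) (measure_mono_ae ?_)
    filter_upwards [N.ae_lt_successProb hα0 hθ hp hp1 hε1] with ω hω hωY
    refine hω ?_
    have hYL : Y ω < ENNReal.ofReal L := not_le.1 hωY
    have h := strictAnti_expNeg hYL
    rwa [expNeg_ofReal hL0.le, hL, neg_neg, Real.exp_log hε] at h
  rw [probReal_compl_eq_one_sub hset] at hle
  have heq : p / (1 - p) * (lam * K) / L = lam * p * K / ((1 - p) * L) := by
    field_simp
  linarith

end RayleighBipolarNetwork

/-! ### The capacity bound -/

/-- `2 (1 - s) / (1 + s) < log (1 / s)` at `s = √(1 - ε)`. -/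
lemma four_mul_sq_one_sub_sqrt_div_lt_neg_log {ε : ℝ} (hε0 : 0 < ε) (hε1 : ε < 1) :
    4 * ((1 - √(1 - ε)) ^ 2 / ε) < -Real.log (1 - ε) := by
  have hε : 0 < 1 - ε := by linarith
  set s := √(1 - ε) with hs
  have hs0 : 0 < s := Real.sqrt_pos.2 hε
  have hss : s ^ 2 = 1 - ε := Real.sq_sqrt hε.le
  have hs1 : s < 1 := by nlinarith
  have hx : 0 < 1 / s - 1 := by rw [sub_pos, lt_div_iff₀ hs0]; linarith
  have h := Real.lt_log_one_add_of_pos hx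
  have hlog : Real.log (1 + (1 / s - 1)) = -Real.log (1 - ε) / 2 := by
    rw [← hss, Real.log_pow, add_sub_cancel, one_div, Real.log_inv]
    push_cast
    ring
  have hfrac : 2 * (1 / s - 1) / (1 / s - 1 + 2) = 2 * ((1 - s) ^ 2 / ε) := by
    have hε' : ε = (1 - s) * (1 + s) := by linarith [hss, sq s]
    have h1s : 1 - s ≠ 0 := by linarith
    have h2s : 1 + s ≠ 0 := by positivity
    have h3s : 1 / s - 1 + 2 = (1 + s) / s := by field_simp; ring
    rw [h3s, hε']
    field_simp
  rw [hlog, hfrac] at h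
  linarith

theorem mainTheorem8
    (N : ∀ lam p : ℝ, 0 < lam → 0 < p → p ≤ 1 → RayleighBipolarNetwork.{u} lam 1 p)
    (α θ ε δ : ℝ) (hα : 2 < α) (hδ : δ = 2 / α) (hθ : 0 < θ) (hε0 : 0 < ε) (hε1 : ε < 1) :
    ENNReal.ofReal
        ((1 - √(1 - ε)) ^ 2 / (ε * θ ^ δ * Real.Gamma (1 + δ) * Real.Gamma (1 - δ)))
      < spatialOutageCapacity N α θ ε := by
  subst hδ
  have hα0 : 0 < α := by linarith
  have hδ' : 0 < 1 - 2 / α := by rw [sub_pos, div_lt_one hα0]; exact hα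
  have hG1 : 0 < Real.Gamma (1 + 2 / α) := Real.Gamma_pos_of_pos (by positivity)
  have hG2 : 0 < Real.Gamma (1 - 2 / α) := Real.Gamma_pos_of_pos hδ'
  obtain ⟨K, hK⟩ : ∃ K, K = θ ^ (2 / α) * Real.Gamma (1 + 2 / α) * Real.Gamma (1 - 2 / α) :=
    ⟨_, rfl⟩
  have hK0 : 0 < K := by rw [hK]; positivity
  obtain ⟨L, hL⟩ : ∃ L, L = -Real.log (1 - ε) := ⟨_, rfl⟩
  have hL0 : 0 < L := by rw [hL]; exact neg_pos.2 (Real.log_neg (by linarith) (by linarith))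
  obtain ⟨t, ht⟩ : ∃ t, t = (1 - √(1 - ε)) ^ 2 / ε := ⟨_, rfl⟩
  have ht0 : 0 ≤ t := by rw [ht]; positivity
  have htL : 4 * t < L := by
    rw [ht, hL]; exact four_mul_sq_one_sub_sqrt_div_lt_neg_log hε0 hε1
  -- with `1 - p` halfway between `4 t / L` and `1`, the bound `(1 - p) L / 4` still exceeds `t`
  obtain ⟨p, hp⟩ : ∃ p, p = (1 - 4 * t / L) / 2 := ⟨_, rfl⟩
  have h4 : 4 * t / L < 1 := (div_lt_one hL0).2 htL
  have h4' : 0 ≤ 4 * t / L := by positivity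
  have hp0 : 0 < p := by linarith
  have hp1 : p < 1 := by linarith
  have hq : 0 < 1 - p := by linarith
  have htp : t < (1 - p) * L / 4 := by
    have h : 4 * t / L < 1 - p := by linarith
    rw [div_lt_iff₀ hL0] at h
    linarith
  -- the maximizer `x = (1 - p) L / (2 K)` of `x (1 - x K / ((1 - p) L))`, where `x = lam * p`
  obtain ⟨lam, hlam⟩ : ∃ lam, lam = (1 - p) * L / (2 * K) / p := ⟨_, rfl⟩
  have hlam0 : 0 < lam := by rw [hlam]; positivity
  have hx : lam * p = (1 - p) * L / (2 * K) := by rw [hlam]; field_simp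
  have heta := (N lam p hlam0 hp0 hp1.le).one_sub_le_eta hα hθ hε0 hε1 hlam0 hp0 hp1
  rw [← hK, ← hL, hx, show 1 - (1 - p) * L / (2 * K) * K / ((1 - p) * L) = 1 / 2 by
    field_simp; ring] at heta
  have htarget : (1 - √(1 - ε)) ^ 2 /
      (ε * θ ^ (2 / α) * Real.Gamma (1 + 2 / α) * Real.Gamma (1 - 2 / α)) = t / K := by
    rw [ht, hK, div_div]
    ring_nf
  have hlt : t / K < lam * p * (N lam p hlam0 hp0 hp1.le).eta α θ ε := by
    have h1 : lam * p * (1 / 2) ≤ lam * p * (N lam p hlam0 hp0 hp1.le).eta α θ ε :=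
      mul_le_mul_of_nonneg_left heta (by positivity)
    have h2 : t / K < lam * p * (1 / 2) := by
      rw [hx, div_lt_iff₀ hK0, show (1 - p) * L / (2 * K) * (1 / 2) * K = (1 - p) * L / 4 by
        field_simp; ring]
      exact htp
    linarith
  rw [htarget, spatialOutageCapacity]
  refine ((ENNReal.ofReal_lt_ofReal_iff_of_nonneg (by positivity)).2 hlt).trans_le ?_
  exact le_iSup_of_le lam (le_iSup_of_le p (le_iSup_of_le hlam0 (le_iSup_of_le hp0
    (le_iSup_of_le hp1.le le_rfl))))
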